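/- Let $n\ge 1$, $e\ge 2$, $S=\mathbb{C}[x_0,\dots,x_n]$, $R=\sum_i x_i\,\partial/\partial x_i$. Let $\omega=\sum_i A_i\,dx_i\neq 0$ be a global section of $\Omega^1_{\mathbb{P}^n}(e)$ (that is, the $A_i\in S$ are homogeneous of degree $e-1$ and $i_R\omega=0$) with $\omega\wedge d\omega=0$. Assume that $\omega$ lies in the generic set $\mathcal{U}'$, i.e. the closed subsets $\mathrm{sing}(\omega)$ and $\mathrm{sing}(d\omega)$ of $\mathbb{P}^n$ defined by the coefficients of $\omega$ and of $d\omega$ satisfy $$\operatorname{codim}(\mathrm{sing}(\omega))\ge 2,\qquad \operatorname{codim}(\mathrm{sing}(d\omega))\ge 3$$ (the empty set has infinite codimension), and that $\omega$ is of split type, i.e. there are polynomial vector fields $X_1,\dots,X_{n-1}$ on $\mathbb{C}^{n+1}$ with $$\omega=i_R\,i_{X_1}\cdots i_{X_{n-1}}\,dx_0\wedge\cdots\wedge dx_n .$$ Define ideals of $S$ by $$J=(A_0,\dots,A_n),\qquad K=\mathrm{ann}\big(\overline{d\omega}\big)+J,\quad \overline{d\omega}\in\Omega^2_S\otimes_S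 S/J,$$ $$I=\{h\in S:\ h\,d\omega=\omega\wedge\eta\ \text{for some}\ \eta\in\Omega^1_S\}$$ (the singular ideal, the Kupka ideal and the ideal of unfoldings). Then: 1. $J=K$; 2. $I=J$; 3. every first order unfolding of $\omega$ is isomorphic to the trivial unfolding. Here a first order unfolding of $\omega$ is a global section $\widetilde\omega$ of $\Omega^1_{\mathbb{P}^n[\varepsilon]}(e)$, where $\mathbb{P}^n[\varepsilon]=\mathbb{P}^n\times\mathrm{Spec}\,\mathbb{C}[\varepsilon]/(\varepsilon^2)$ and differentials are taken over $\mathbb{C}$ (so $d\varepsilon$ is allowed), such that $\widetilde\omega\wedge d\widetilde\omega=0$ and $\widetilde\omega$ restricts to $\omega$ on the central fibre $\varepsilon=0$. The trivial unfolding is the pullback of $\omega$ under the projection $\mathbb{P}^n[\varepsilon]\to\mathbb{P}^n$. Two unfoldings $\widetilde\omega,\widehat\omega$ are isomorphic if there is an automorphism $\phi$ of $\mathbb{P}^n[\varepsilon]$ over $\mathbb{C}[\varepsilon]$ that restricts to the identity on the central fibre and satisfies $\phi^*\widetilde\omega=\widehat\omega$ (for a lift of $\phi$ to a graded automorphism of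 $S[\varepsilon]$ that is the identity modulo $\varepsilon$). -/

import Mathlib

noncomputable section

namespace ProjFoliation

/-! ### Polynomial forms and vector fields on the affine cone of projective space -/

/-- The homogeneous coordinate ring `S = ℂ[x₀, …, xₙ]` of `ℙⁿ`. -/
abbrev CoordRing (n : ℕ) : Type := MvPolynomial (Fin (n + 1)) ℂ

/-- A polynomial vector field `∑ Xᵢ ∂/∂xᵢ` on `ℂⁿ⁺¹`, given by its coefficients. -/
abbrev VectorField (n : ℕ) : Type := Fin (n + 1) → CoordRing n

/-- A polynomial differential 1-form `∑ Aᵢ dxᵢ` (an element of the free module `Ω¹_S`),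
given by its coefficients. -/
abbrev OneForm (n : ℕ) : Type := Fin (n + 1) → CoordRing n

/-- The radial vector field `R = ∑ xᵢ ∂/∂xᵢ`. -/
def radial (n : ℕ) : VectorField n := fun i => MvPolynomial.X i

/-- The coordinate vector field `∂/∂xᵢ`. -/
def coordField {n : ℕ} (i : Fin (n + 1)) : VectorField n := Pi.single i 1

/-- The contraction `i_X ω`. -/
def contract {n : ℕ} (X : VectorField n) (ω : OneForm n) : CoordRing n := ∑ i, X i * ω i

/-- The 2-form `dω`; the value at `(i, j)` is `dω(∂ᵢ, ∂ⱼ)`, the coefficient of `dxᵢ ∧ dxⱼ`. -/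
def exteriorD {n : ℕ} (ω : OneForm n) (i j : Fin (n + 1)) : CoordRing n :=
  MvPolynomial.pderiv i (ω j) - MvPolynomial.pderiv j (ω i)

/-- The coefficients of the wedge product of two 1-forms in the variables `dxᵢ`. -/
def wedgeOneOne {ι A : Type*} [CommRing A] (a b : ι → A) (i j : ι) : A :=
  a i * b j - a j * b i

/-- The coefficients of the wedge product of a 1-form with a 2-form in the variables `dxᵢ`. -/
def wedgeOneTwo {ι A : Type*} [CommRing A] (a : ι → A) (B : ι → ι → A) (i j k : ι) : A :=
  a i * B j k - a j * B i k + a k * B i j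

/-! ### Foliations of codimension one on `ℙⁿ` -/

/-- The standard grading of `S`. -/
abbrev grading (n : ℕ) : ℕ → Submodule ℂ (CoordRing n) :=
  MvPolynomial.homogeneousSubmodule (Fin (n + 1)) ℂ

instance gradedAlgebraCoordRing (n : ℕ) : GradedAlgebra (grading n) :=
  MvPolynomial.gradedAlgebra

/-- The codimension in `ℙⁿ` of the closed subset defined by a set of polynomials: the infimum of
the heights of the homogeneous primes (different from the irrelevant ideal) containing them; the
empty set has codimension `⊤`. -/
def projCodim {n : ℕ} (s : Set (CoordRing n)) : ℕ∞ :=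
  ⨅ p ∈ ProjectiveSpectrum.zeroLocus (grading n) s, p.asHomogeneousIdeal.toIdeal.height

/-- `codim (sing ω)` in `ℙⁿ`. -/
def codimSing {n : ℕ} (ω : OneForm n) : ℕ∞ := projCodim (Set.range ω)

/-- `codim (sing dω)` in `ℙⁿ`. -/
def codimSingDeriv {n : ℕ} (ω : OneForm n) : ℕ∞ :=
  projCodim (Set.range fun ij : Fin (n + 1) × Fin (n + 1) => exteriorD ω ij.1 ij.2)

/-- `ω` is a nonzero integrable global section of `Ω¹_{ℙⁿ}(e)` whose singular locus has codimension
at least two, i.e. `ω` represents a point of `𝓕¹(ℙⁿ, e)`. -/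
structure IsFoliation {n : ℕ} (e : ℕ) (ω : OneForm n) : Prop where
  two_le : 2 ≤ e
  ne_zero : ω ≠ 0
  homogeneous : ∀ i, (ω i).IsHomogeneous (e - 1)
  contract_radial : contract (radial n) ω = 0
  integrable : wedgeOneTwo ω (exteriorD ω) = 0
  two_le_codim : 2 ≤ codimSing ω

/-- The generic open set `𝒰'` of foliations with `codim (sing ω) ≥ 2` and
`codim (sing dω) ≥ 3`. -/
def IsGeneric {n : ℕ} (e : ℕ) (ω : OneForm n) : Prop :=
  IsFoliation e ω ∧ 2 ≤ codimSing ω ∧ 3 ≤ codimSingDeriv ω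

/-- A 1-form on `ℙᵐ⁺¹` is of split type if
`ω = i_R i_{X₁} ⋯ i_{Xₘ} (dx₀ ∧ ⋯ ∧ dxₘ₊₁)` for some polynomial vector fields `X₁, …, Xₘ`, i.e.
`ω(∂ᵢ) = (dx₀ ∧ ⋯ ∧ dxₘ₊₁)(Xₘ, …, X₁, R, ∂ᵢ)`; the volume form is the
determinant of the rows of coefficients. -/
def IsSplit {m : ℕ} (ω : OneForm (m + 1)) : Prop :=
  ∃ X : Fin m → VectorField (m + 1), ∀ i : Fin (m + 2),
    ω i = Matrix.det (Matrix.of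
      (Fin.snoc (α := fun _ => VectorField (m + 1))
        (Fin.snoc (α := fun _ => VectorField (m + 1)) (fun j => X j.rev) (radial (m + 1)))
        (coordField i)))

/-! ### The singular ideal, the Kupka ideal and the ideal of unfoldings -/

/-- The singular ideal `J(ω)`, generated by the coefficients of `ω`. -/
def singIdeal {n : ℕ} (ω : OneForm n) : Ideal (CoordRing n) := Ideal.span (Set.range ω)

/-- The Kupka ideal `K(ω) = ann (dω mod J) + J`, where `dω mod J` is the class of `dω` in
`Ω²_S ⊗ S/J`, a free `S/J`-module whose elements are written as matrices of coefficients. -/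
def kupkaIdeal {n : ℕ} (ω : OneForm n) : Ideal (CoordRing n) :=
  Ideal.torsionOf (CoordRing n) (Fin (n + 1) → Fin (n + 1) → CoordRing n ⧸ singIdeal ω)
      (fun i j => Ideal.Quotient.mk (singIdeal ω) (exteriorD ω i j))
    ⊔ singIdeal ω

/-- The ideal of unfoldings `I(ω) = {h ∈ S : h dω = ω ∧ η for some η ∈ Ω¹_S}`. -/
def unfoldingIdeal {n : ℕ} (ω : OneForm n) : Ideal (CoordRing n) where
  carrier := {h | ∃ η : OneForm n, ∀ i j, h * exteriorD ω i j = wedgeOneOne ω η i j}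
  zero_mem' := ⟨0, fun i j => by simp [wedgeOneOne]⟩
  add_mem' := by
    rintro a b ⟨η, hη⟩ ⟨ξ, hξ⟩
    refine ⟨η + ξ, fun i j => ?_⟩
    rw [add_mul, hη, hξ]
    simp only [wedgeOneOne, Pi.add_apply]
    ring
  smul_mem' := by
    rintro c a ⟨η, hη⟩
    refine ⟨c • η, fun i j => ?_⟩
    rw [smul_eq_mul, mul_assoc, hη]
    simp only [wedgeOneOne, Pi.smul_apply, smul_eq_mul]
    ring

/-! ### First order unfoldings

The homogeneous coordinate ring of `ℙⁿ[ε] = ℙⁿ × Spec ℂ[ε]` is `S[ε]`. Since `ε² = 0` forces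
`ε dε = 0`, its differentials over `ℂ` are
`Ω¹ = ⨁ S[ε] dxᵢ ⊕ S dε`, `Ω² = ⨁_{i<j} S[ε] dxᵢ ∧ dxⱼ ⊕ ⨁ S dε ∧ dxⱼ`,
`Ω³ = ⨁_{i<j<k} S[ε] dxᵢ ∧ dxⱼ ∧ dxₖ ⊕ ⨁_{i<j} S dε ∧ dxᵢ ∧ dxⱼ`, and in each case `S[ε]` acts on
the summands that contain `dε` through `ε ↦ 0`. -/

/-- `S[ε]`, with `ε² = 0`. -/
abbrev ThickRing (n : ℕ) : Type := DualNumber (CoordRing n)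

/-- The partial derivative `∂/∂xᵢ` on `S[ε]`. -/
def thickPderiv {n : ℕ} (i : Fin (n + 1)) (a : ThickRing n) : ThickRing n :=
  TrivSqZeroExt.inl (MvPolynomial.pderiv i a.fst) + TrivSqZeroExt.inr (MvPolynomial.pderiv i a.snd)

/-- A 1-form `∑ aᵢ dxᵢ + h dε` on the cone over `ℙⁿ[ε]`. -/
@[ext]
structure ThickOneForm (n : ℕ) where
  dx : Fin (n + 1) → ThickRing n
  de : CoordRing n

/-- The `dxᵢ ∧ dxⱼ` coefficient of the exterior derivative of `∑ aᵢ dxᵢ + h dε`. -/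
def ThickOneForm.derivDx {n : ℕ} (w : ThickOneForm n) (i j : Fin (n + 1)) : ThickRing n :=
  thickPderiv i (w.dx j) - thickPderiv j (w.dx i)

/-- The `dε ∧ dxⱼ` coefficient of the exterior derivative of `∑ aᵢ dxᵢ + h dε`. -/
def ThickOneForm.derivDe {n : ℕ} (w : ThickOneForm n) (j : Fin (n + 1)) : CoordRing n :=
  (w.dx j).snd - MvPolynomial.pderiv j w.de

/-- The Frobenius condition `w ∧ dw = 0` in `Ω³` of `S[ε]` over `ℂ`: the coefficients of
`dxᵢ ∧ dxⱼ ∧ dxₖ` and those of `dε ∧ dxᵢ ∧ dxⱼ` vanish. -/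
def ThickOneForm.Integrable {n : ℕ} (w : ThickOneForm n) : Prop :=
  wedgeOneTwo w.dx w.derivDx = 0 ∧
    ∀ i j, w.de * (w.derivDx i j).fst - wedgeOneOne (fun k => (w.dx k).fst) w.derivDe i j = 0

/-- `w` is a first order unfolding of `ω`, a global section of `Ω¹_{ℙⁿ}(e)`: it is an integrable
global section of `Ω¹_{ℙⁿ[ε]}(e)` that restricts to `ω` on the central fibre `ε = 0`. -/
structure IsUnfolding {n : ℕ} (e : ℕ) (ω : OneForm n) (w : ThickOneForm n) : Prop where
  homogeneous_fst : ∀ i, (w.dx i).fst.IsHomogeneous (e - 1)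
  homogeneous_snd : ∀ i, (w.dx i).snd.IsHomogeneous (e - 1)
  homogeneous_de : w.de.IsHomogeneous e
  contract_radial : ∑ i, (TrivSqZeroExt.inl (radial n i) : ThickRing n) * w.dx i = 0
  integrable : w.Integrable
  restrict : ∀ i, (w.dx i).fst = ω i

/-- The trivial unfolding: the pullback of `ω` by the projection `ℙⁿ[ε] → ℙⁿ`. -/
def trivialUnfolding {n : ℕ} (ω : OneForm n) : ThickOneForm n where
  dx := fun i => TrivSqZeroExt.inl (ω i)
  de := 0

/-- An automorphism of `ℙⁿ[ε]` over `ℂ[ε]` that restricts to the identity on the central fibre,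
given by a graded `ℂ[ε]`-algebra automorphism of `S[ε]` that is the identity modulo `ε`. -/
structure ThickAut (n : ℕ) where
  toAlgEquiv : ThickRing n ≃ₐ[ℂ] ThickRing n
  map_eps : toAlgEquiv DualNumber.eps = DualNumber.eps
  restrict : ∀ a, (toAlgEquiv a).fst = a.fst
  graded : ∀ i, (toAlgEquiv (TrivSqZeroExt.inl (MvPolynomial.X i))).snd.IsHomogeneous 1

/-- The image `φ(xⱼ)` of a homogeneous coordinate. -/
def ThickAut.coord {n : ℕ} (φ : ThickAut n) (j : Fin (n + 1)) : ThickRing n :=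
  φ.toAlgEquiv (TrivSqZeroExt.inl (MvPolynomial.X j))

/-- The pullback of differential forms, `φ^*(∑ aⱼ dxⱼ + h dε) = ∑ φ(aⱼ) d(φ(xⱼ)) + h dε`, where
`da = ∑ (∂a/∂xᵢ) dxᵢ + (∂a/∂ε) dε`. -/
def ThickAut.pullback {n : ℕ} (φ : ThickAut n) (w : ThickOneForm n) : ThickOneForm n where
  dx := fun i => ∑ j, φ.toAlgEquiv (w.dx j) * thickPderiv i (φ.coord j)
  de := w.de + ∑ j, (φ.toAlgEquiv (w.dx j)).fst * (φ.coord j).snd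

/-- Two unfoldings are isomorphic if an automorphism of `ℙⁿ[ε]` that restricts to the identity on
the central fibre pulls the first one back to the second one. -/
def IsomorphicUnfoldings {n : ℕ} (w w' : ThickOneForm n) : Prop :=
  ∃ φ : ThickAut n, φ.pullback w = w'

end ProjFoliation

end

/-! Everything follows from one fact, `mem_singIdeal_of_mul_exteriorD_mem`: an `h` that multiplies
all coefficients of `dω` into `J` lies in `J`. Splitness makes the `A_i` the maximal minors of a
matrix with one row fewer than columns, and they have no common prime factor, so by Hilbert–Burch
the rows are a basis of the syzygies of `J` (`Matrix.exists_eq_sum_smul_of_minors`). Such a `J` has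
no associated prime of height at least three: that prime would contain a regular sequence of length
three (`exists_regular_triple`), and chasing syzygies excludes this
(`mem_span_range_of_regular_triple`). Primes containing the coefficients of `dω` do have height at
least three, except on `ℙ¹`, where `dω` has a unit coefficient.

The equality `J = K` and the inclusion `I ⊆ J` are then immediate, and `J ⊆ I` is integrability
contracted with `∂_k`. For an unfolding `ω + ε ω₁ + h dε`, integrability gives `h dω = ω ∧ (ω₁ -
dh)`, so `h ∈ I = J` and `h = i_Y ω` with `Y` linear. Then `ω₁ - L_Y ω` is proportional to `ω`, by
degree a constant multiple of it, and a multiple of `R` absorbs it because `L_R ω = e ω` and `i_R ω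
= 0`. -/

namespace MvPolynomial

/-! ### Nagata's change of variables -/

section Nagata

variable {k : Type*} [Field k] {n : ℕ}

/-- Nagata's change of variables `X_i ↦ X_i + c X_0 ^ (N ^ i)` for `i ≠ 0`. -/
noncomputable def nagataHom (n N : ℕ) (c : k) :
    MvPolynomial (Fin (n + 1)) k →ₐ[k] MvPolynomial (Fin (n + 1)) k :=
  aeval fun i ↦ if i = 0 then X 0 else X i + c • X 0 ^ (N ^ i.1)

lemma nagataHom_comp_neg (N : ℕ) (c : k) :
    (nagataHom n N c).comp (nagataHom n N (-c)) = AlgHom.id _ _ := by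
  unfold nagataHom
  rw [comp_aeval, ← MvPolynomial.aeval_X_left]
  ext i v
  cases i using Fin.cases <;> simp

/-- Nagata's change of variables as an automorphism. -/
noncomputable def nagataEquiv (k : Type*) [Field k] (n N : ℕ) :
    MvPolynomial (Fin (n + 1)) k ≃ₐ[k] MvPolynomial (Fin (n + 1)) k :=
  AlgEquiv.ofAlgHom (nagataHom n N 1) (nagataHom n N (-1))
    (nagataHom_comp_neg N 1) (by simpa using nagataHom_comp_neg N (-1 : k))

lemma nagataEquiv_X_zero (N : ℕ) : nagataEquiv k n N (X 0) = X 0 := by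
  simp [nagataEquiv, nagataHom]

lemma nagataEquiv_X_succ (N : ℕ) (i : Fin n) :
    nagataEquiv k n N (X i.succ) = X i.succ + X 0 ^ (N ^ (i.1 + 1)) := by
  simp [nagataEquiv, nagataHom]

/-- The exponents are the base `N` digits of the weight, so the weight determines them. -/
lemma sum_pow_mul_ne {N : ℕ} (hN : 2 ≤ N) {v w : Fin (n + 1) →₀ ℕ} (vlt : ∀ i, v i < N)
    (wlt : ∀ i, w i < N) (ne : v ≠ w) :
    ∑ x : Fin (n + 1), N ^ x.1 * v x ≠ ∑ x : Fin (n + 1), N ^ x.1 * w x := by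
  intro h
  refine ne <| Finsupp.ext <| congrFun <| List.ofFn_inj.mp ?_
  apply Nat.ofDigits_inj_of_len_eq (b := N) (by omega) (by simp)
    (List.forall_mem_ofFn_iff.mpr vlt) (List.forall_mem_ofFn_iff.mpr wlt)
  simpa only [Nat.ofDigits_eq_sum_mapIdx, List.mapIdx_eq_ofFn, List.get_ofFn, List.length_ofFn,
    Fin.val_cast, mul_comm, List.sum_ofFn] using! h

/-- The image of a monomial under Nagata's change of variables, as a polynomial in `X_0`, has
constant leading coefficient, and its degree is the weight of the monomial. -/
lemma finSuccEquiv_nagata_monomial {N : ℕ} (hN : 2 ≤ N) (v : Fin (n + 1) →₀ ℕ) {a : k}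
    (ha : a ≠ 0) :
    (finSuccEquiv k n (nagataEquiv k n N (monomial v a))).leadingCoeff = C a ∧
    (finSuccEquiv k n (nagataEquiv k n N (monomial v a))).natDegree =
      ∑ i : Fin (n + 1), N ^ i.1 * v i := by
  have hpos (i : Fin n) : 0 < N ^ (i.1 + 1) := by positivity
  have hmonic (i : Fin n) : (Polynomial.C (X (R := k) i) +
      Polynomial.X ^ (N ^ (i.1 + 1))).Monic := by
    rw [add_comm]
    exact Polynomial.leadingCoeff_X_pow_add_C (hpos i)
  have hdeg (i : Fin n) : (Polynomial.C (X (R := k) i) +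
      Polynomial.X ^ (N ^ (i.1 + 1))).natDegree = N ^ (i.1 + 1) := by
    rw [add_comm, Polynomial.natDegree_X_pow_add_C]
  have key : finSuccEquiv k n (nagataEquiv k n N (monomial v a)) =
      Polynomial.C (C a) * (Polynomial.X ^ v 0 *
        ∏ i : Fin n, (Polynomial.C (X i) + Polynomial.X ^ (N ^ (i.1 + 1))) ^ v i.succ) := by
    rw [monomial_eq, Finsupp.prod_pow v fun i ↦ X i, ← algebraMap_eq]
    simp only [Fin.prod_univ_succ, map_mul, map_prod, map_pow, AlgEquiv.commutes,
      nagataEquiv_X_zero, nagataEquiv_X_succ, map_add, finSuccEquiv_X_zero, finSuccEquiv_X_succ]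
    rfl
  have hprod : (∏ i : Fin n, (Polynomial.C (X (R := k) i) +
      Polynomial.X ^ (N ^ (i.1 + 1))) ^ v i.succ).Monic :=
    Polynomial.monic_prod_of_monic _ _ fun i _ => (hmonic i).pow _
  have hq := (Polynomial.monic_X_pow (R := MvPolynomial (Fin n) k) (v 0)).mul hprod
  constructor
  · rw [key, Polynomial.leadingCoeff_mul, hq.leadingCoeff, Polynomial.leadingCoeff_C, mul_one]
  · rw [key, Polynomial.natDegree_C_mul (by simpa using ha),
      (Polynomial.monic_X_pow _).natDegree_mul hprod, Polynomial.natDegree_X_pow,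
      Polynomial.natDegree_prod_of_monic _ _ fun i _ => (hmonic i).pow _, Fin.sum_univ_succ]
    simp only [(hmonic _).natDegree_pow, hdeg, Fin.val_zero, pow_zero, one_mul, Fin.val_succ,
      mul_comm]

/-- A nonzero polynomial over a field becomes monic in one variable, up to a unit, after an
automorphism. -/
theorem exists_algEquiv_isUnit_leadingCoeff {f : MvPolynomial (Fin (n + 1)) k} (hf : f ≠ 0) :
    ∃ e : MvPolynomial (Fin (n + 1)) k ≃ₐ[k] Polynomial (MvPolynomial (Fin n) k),
      IsUnit (e f).leadingCoeff := by
  classical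
  -- This `N` exceeds every exponent in `f`, so distinct monomials have distinct weights and the one
  -- of largest weight supplies the leading term.
  obtain ⟨N, hN⟩ : ∃ N, N = 2 + f.totalDegree := ⟨_, rfl⟩
  obtain ⟨D, hD⟩ : ∃ D : (Fin (n + 1) →₀ ℕ) → ℕ,
    ∀ v, D v = ∑ i : Fin (n + 1), N ^ i.1 * v i := ⟨_, fun _ => rfl⟩
  obtain ⟨e, he⟩ : ∃ e : MvPolynomial (Fin (n + 1)) k ≃ₐ[k] Polynomial (MvPolynomial (Fin n) k),
    ∀ p, e p = finSuccEquiv k n (nagataEquiv k n N p) :=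
    ⟨(nagataEquiv k n N).trans (finSuccEquiv k n), fun _ => rfl⟩
  obtain ⟨h, hh⟩ : ∃ h : (Fin (n + 1) →₀ ℕ) → Polynomial (MvPolynomial (Fin n) k),
    ∀ w, h w = e (monomial w (coeff w f)) := ⟨_, fun _ => rfl⟩
  have hmon : ∀ v ∈ f.support, (h v).leadingCoeff = C (coeff v f) ∧ (h v).natDegree = D v := by
    intro v hv
    rw [hh, he, hD]
    exact finSuccEquiv_nagata_monomial (by omega) v (mem_support_iff.mp hv)
  have hlt : ∀ v ∈ f.support, ∀ i, v i < N := fun v hv i =>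
    lt_of_le_of_lt ((monomial_le_degreeOf i hv).trans (degreeOf_le_totalDegree f i)) (by omega)
  obtain ⟨v, hv, hmax⟩ := Finset.exists_max_image f.support D (support_nonempty.mpr hf)
  have hne : h v ≠ 0 := fun h0 => by
    have := (hmon v hv).1
    rw [h0, Polynomial.leadingCoeff_zero] at this
    exact mem_support_iff.mp hv ((C_eq_zero).mp this.symm)
  have hdeg : ∀ w ∈ f.support.erase v, (h w).degree < (h v).degree := by
    intro w hw
    obtain ⟨hwv, hw⟩ := Finset.mem_erase.mp hw
    apply Polynomial.degree_lt_degree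
    rw [(hmon w hw).2, (hmon v hv).2]
    refine lt_of_le_of_ne (hmax w hw) ?_
    rw [hD, hD]
    exact (sum_pow_mul_ne (by omega) (hlt w hw) (hlt v hv) hwv)
  refine ⟨e, ?_⟩
  have hsum : e f = h v + ∑ w ∈ f.support.erase v, h w := by
    rw [Finset.add_sum_erase _ _ hv]
    simp only [hh]
    rw [← map_sum, ← f.as_sum]
  rw [hsum, Polynomial.leadingCoeff_add_of_degree_lt', (hmon v hv).1]
  · exact (mem_support_iff.mp hv).isUnit.map C
  · exact (Polynomial.degree_sum_le _ _).trans_lt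
      ((Finset.sup_lt_iff (bot_lt_iff_ne_bot.mpr (mt Polynomial.degree_eq_bot.mp hne))).mpr hdeg)

end Nagata

end MvPolynomial

/-! ### Regular sequences and heights of primes in polynomial rings -/

open Polynomial in
lemma Polynomial.Monic.dvd_of_dvd_C_mul {T : Type*} [CommRing T] [IsDomain T] {g : T[X]}
    (hg : g.Monic) {a : T} (ha : a ≠ 0) {w : T[X]} (h : g ∣ C a * w) : g ∣ w := by
  rw [← modByMonic_eq_zero_iff_dvd hg] at h ⊢
  rw [← smul_eq_C_mul, smul_modByMonic, smul_eq_zero] at h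
  exact h.resolve_left ha

open Polynomial in
/-- If `a, b` is a regular sequence in `T` and `g` is monic, then `b` is regular modulo `(g, a)`. -/
lemma Polynomial.Monic.exists_eq_of_dvd_sub {T : Type*} [CommRing T] {g : T[X]}
    (hg : g.Monic) {a b : T} (hab : ∀ c, a ∣ b * c → a ∣ c) {y z : T[X]}
    (h : g ∣ C b * y - C a * z) : ∃ y' w, y = C a * y' + g * w := by
  rw [← modByMonic_eq_zero_iff_dvd hg, sub_modByMonic, ← smul_eq_C_mul, ← smul_eq_C_mul,
    smul_modByMonic, smul_modByMonic, sub_eq_zero] at h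
  have : C a ∣ y %ₘ g := by
    rw [C_dvd_iff_dvd_coeff]
    intro i
    refine hab _ ⟨(z %ₘ g).coeff i, ?_⟩
    simpa using congrArg (fun p => p.coeff i) h
  obtain ⟨y', hy'⟩ := this
  exact ⟨y', y /ₘ g, by rw [← hy', modByMonic_add_div]⟩

/-- The source of the regular pairs below: a prime element followed by any non-multiple of it. -/
lemma dvd_of_dvd_mul_of_prime_of_not_dvd {T : Type*} [CommMonoidWithZero T] {a b : T}
    (ha : Prime a) (hb : ¬ a ∣ b) (c : T) (h : a ∣ b * c) : a ∣ c :=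
  (ha.dvd_or_dvd h).resolve_left hb

open Polynomial in
/-- Primes that annihilate a nonzero class modulo a regular sequence `g, f` of length two in `T[X]`,
with `g` monic, have height at most two. -/
theorem Polynomial.height_le_two_of_monic {T : Type*} [CommRing T] [IsDomain T]
    [UniqueFactorizationMonoid T] [IsNoetherianRing T] {g f : T[X]} (hg : g.Monic)
    (hgf : ∀ c, g ∣ f * c → g ∣ c) (P : Ideal T[X]) [P.IsPrime] (hgP : g ∈ P) {x : T[X]}
    (hx : x ∉ Ideal.span {g, f}) (hPx : ∀ a ∈ P, a * x ∈ Ideal.span {g, f}) : P.height ≤ 2 := by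
  set p := P.comap (C : T →+* T[X]) with hp
  have hpp : p.IsPrime := Ideal.IsPrime.comap _
  -- Write `a x = u g + y f` and `b x = v g + z f`. Eliminating `x` gives `g ∣ b y - a z`, hence `y
  -- = a y' + g w`; then `g` divides `a (x - f y')`, hence `x - f y'`, which puts `x` in `(g, f)`.
  have no_regular : ∀ a ∈ p, ∀ b ∈ p, a ≠ 0 → (∀ c, a ∣ b * c → a ∣ c) → False := by
    intro a ha b hb ha0 hab
    obtain ⟨u, y, h1⟩ := Ideal.mem_span_pair.mp (hPx _ ha)
    obtain ⟨v, z, h2⟩ := Ideal.mem_span_pair.mp (hPx _ hb)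
    obtain ⟨y', w, hy⟩ := hg.exists_eq_of_dvd_sub hab (y := y) (z := z)
      (hgf _ ⟨C a * v - C b * u, by linear_combination C b * h1 - C a * h2⟩)
    obtain ⟨t, ht⟩ := hg.dvd_of_dvd_C_mul ha0 (w := x - f * y')
      ⟨u + f * w, by rw [hy] at h1; linear_combination -h1⟩
    exact hx (Ideal.mem_span_pair.mpr ⟨t, y', by linear_combination -ht⟩)
  have hprinc : p.IsPrincipal := by
    by_cases hbot : p = ⊥
    · rw [hbot]; infer_instance
    · obtain ⟨a, ha, hprime⟩ := hpp.exists_mem_prime_of_ne_bot hbot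
      -- A prime element of `p` generates it, since any other element outside `(a)` would complete
      -- `a` to a regular pair.
      refine ⟨a, le_antisymm (fun b hb => ?_) ((Ideal.span_singleton_le_iff_mem _).mpr ha)⟩
      by_contra hab
      rw [Ideal.submodule_span_eq, Ideal.mem_span_singleton] at hab
      exact no_regular a ha b hb hprime.ne_zero
        (dvd_of_dvd_mul_of_prime_of_not_dvd hprime hab)
  let B := T[X] ⧸ Ideal.span {g}
  have hint : Algebra.IsIntegral T B := ⟨fun b => hg.quotient_isIntegral
    (Ideal.mem_span_singleton_self g) b⟩
  let Q : Ideal B := P.map (Ideal.Quotient.mk (Ideal.span {g}))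
  have hle : Ideal.span {g} ≤ P := (Ideal.span_singleton_le_iff_mem _).mpr hgP
  have hQ : Q.IsPrime := Ideal.map_isPrime_of_surjective Ideal.Quotient.mk_surjective
    (by rwa [Ideal.mk_ker])
  have hunder : Q.under T = p := by
    have : algebraMap T B = (Ideal.Quotient.mk (Ideal.span {g})).comp C := rfl
    rw [Ideal.under_def, this, ← Ideal.comap_comap, Ideal.comap_map_of_surjective'
      _ Ideal.Quotient.mk_surjective, Ideal.mk_ker, sup_eq_left.mpr hle]
  have hmin := Ideal.IsIntegral.mem_minimalPrimes_map_under (R := T) Q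
  rw [hunder] at hmin
  have hmap : (p.map (algebraMap T B)).IsPrincipal := by
    obtain ⟨a, ha⟩ := hprinc
    exact ⟨algebraMap T B a, by rw [ha, Ideal.submodule_span_eq, Ideal.map_span]; simp⟩
  have h1 : Q.height ≤ 1 := Ideal.height_le_one_of_isPrincipal_of_mem_minimalPrimes _ _ hmin
  calc P.height ≤ Q.height + 1 := Ideal.height_le_height_add_one_of_mem hgP
    _ ≤ 1 + 1 := by gcongr
    _ = 2 := by norm_num

/-- Primes that annihilate a nonzero class modulo a regular sequence `g, f` of length two in a
polynomial ring over a field have height at most two. -/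
theorem MvPolynomial.height_le_two_of_regular_pair {k : Type*} [Field k] {n : ℕ}
    {g f : MvPolynomial (Fin n) k} (hg : g ≠ 0) (hgf : ∀ c, g ∣ f * c → g ∣ c)
    (P : Ideal (MvPolynomial (Fin n) k)) [P.IsPrime] (hgP : g ∈ P) {x : MvPolynomial (Fin n) k}
    (hx : x ∉ Ideal.span {g, f}) (hPx : ∀ a ∈ P, a * x ∈ Ideal.span {g, f}) : P.height ≤ 2 := by
  cases n with
  | zero =>
    refine absurd (Ideal.eq_top_of_isUnit_mem P hgP ?_) (Ideal.IsPrime.ne_top ‹_›)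
    rw [eq_C_of_isEmpty g] at hg ⊢
    exact ((C_ne_zero (σ := Fin 0)).mp hg).isUnit.map C
  | succ n =>
    obtain ⟨e, u, hu⟩ := exists_algEquiv_isUnit_leadingCoeff hg
    let v : Polynomial (MvPolynomial (Fin n) k) := Polynomial.C
      ((u⁻¹ : (MvPolynomial (Fin n) k)ˣ) : MvPolynomial (Fin n) k)
    have hv : IsUnit v := u⁻¹.isUnit.map Polynomial.C
    have hmonic : (e g * v).Monic := by
      rw [Polynomial.Monic, Polynomial.leadingCoeff_mul, Polynomial.leadingCoeff_C, ← hu]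
      simp
    have hspan : ∀ y, e y ∈ Ideal.span {e g * v, e f} ↔ y ∈ Ideal.span {g, f} := by
      intro y
      rw [Ideal.span_insert, Ideal.span_singleton_mul_right_unit hv, ← Ideal.span_insert,
        ← Set.image_pair, ← Ideal.map_span, Ideal.mem_map_iff_of_surjective e e.surjective]
      exact ⟨fun ⟨z, hz, hzy⟩ => e.injective hzy ▸ hz, fun h => ⟨y, h, rfl⟩⟩
    have hcomap : (P.comap e.symm.toRingEquiv).height = P.height :=
      e.symm.toRingEquiv.height_comap P
    have hprime : (P.comap e.symm.toRingEquiv).IsPrime := Ideal.IsPrime.comap _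
    rw [← hcomap]
    refine Polynomial.height_le_two_of_monic (f := e f) (x := e x) hmonic ?_ _ ?_ ?_ ?_
    · intro c hc
      rw [hv.mul_right_dvd] at hc ⊢
      obtain ⟨c, rfl⟩ := e.surjective c
      rw [← map_mul] at hc
      exact (map_dvd_iff e).mpr (hgf c ((map_dvd_iff e).mp hc))
    · exact Ideal.mul_mem_right _ _ (by simpa using hgP)
    · rwa [hspan]
    · intro a ha
      obtain ⟨a, rfl⟩ := e.surjective a
      rw [← map_mul, hspan]
      exact hPx a (by simpa using ha)

/-- A prime of height at least three in a polynomial ring over a field contains a regular sequence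
of length three. -/
theorem MvPolynomial.exists_regular_triple {k : Type*} [Field k] {n : ℕ}
    (P : Ideal (MvPolynomial (Fin n) k)) [P.IsPrime] (hP : 3 ≤ P.height) :
    ∃ f₁ ∈ P, ∃ f₂ ∈ P, ∃ f₃ ∈ P, f₁ ≠ 0 ∧ (∀ c, f₁ ∣ f₂ * c → f₁ ∣ c) ∧
      ∀ c, f₃ * c ∈ Ideal.span {f₁, f₂} → c ∈ Ideal.span {f₁, f₂} := by
  have hbot : P ≠ ⊥ := by
    rintro rfl
    rw [Ideal.height_bot] at hP
    exact absurd hP (by norm_num)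
  obtain ⟨f₁, h1, hprime⟩ := Ideal.IsPrime.exists_mem_prime_of_ne_bot ‹_› hbot
  obtain ⟨f₂, h2, h12⟩ : ∃ f₂ ∈ P, ¬ f₁ ∣ f₂ := by
    by_contra! h
    have : P ≤ Ideal.span {f₁} := fun x hx => Ideal.mem_span_singleton.mpr (h x hx)
    have := hP.trans ((Ideal.height_mono this).trans
      (Ideal.height_span_singleton_le_one hprime.not_isUnit))
    exact absurd this (by norm_num)
  have h12 := dvd_of_dvd_mul_of_prime_of_not_dvd hprime h12
  refine ⟨f₁, h1, f₂, h2, ?_⟩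
  by_contra! h
  set I := Ideal.span {f₁, f₂} with hI
  set R := MvPolynomial (Fin n) k
  have hsub : (P : Set R) ⊆ ⋃ p ∈ associatedPrimes R (R ⧸ I), p := by
    intro f₃ h3
    obtain ⟨c, hc, hcI⟩ := h f₃ h3 hprime.ne_zero h12
    rw [biUnion_associatedPrimes_eq_zero_divisors]
    refine ⟨Ideal.Quotient.mk I c, mt Ideal.Quotient.eq_zero_iff_mem.mp hcI, ?_⟩
    exact Ideal.Quotient.eq_zero_iff_mem.mpr hc
  -- Prime avoidance: if every element of `P` is a zero divisor modulo `(f₁, f₂)`, a single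
  -- associated prime contains `P`.
  obtain ⟨Q, hQ, hPQ⟩ := (Ideal.subset_union_prime_finite (associatedPrimes.finite R (R ⧸ I))
    (f := id) ⊥ ⊥ fun q hq _ _ => hq.isPrime).mp hsub
  obtain ⟨hQp, x, hx⟩ := isAssociatedPrime_iff.mp hQ
  obtain ⟨x, rfl⟩ := Ideal.Quotient.mk_surjective x
  have hmem : ∀ a, a ∈ Q ↔ a * x ∈ I := by
    intro a
    rw [hx, Submodule.mem_colon_singleton, Submodule.mem_bot]
    exact Ideal.Quotient.eq_zero_iff_mem
  have hle := height_le_two_of_regular_pair hprime.ne_zero h12 Q (hPQ h1) (x := x)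
    (fun hxI => hQp.ne_top ((Ideal.eq_top_iff_one _).mpr ((hmem 1).mpr (by simpa using hxI))))
    fun a ha => (hmem a).mp ha
  exact absurd (hP.trans ((Ideal.height_mono hPQ).trans hle)) (by norm_num)

/-- Maximal ideals of a polynomial ring in `n` variables over a field have height `n`. -/
theorem MvPolynomial.height_of_isMaximal {k : Type*} [Field k] {n : ℕ}
    (M : Ideal (MvPolynomial (Fin n) k)) [M.IsMaximal] : M.height = n := by
  induction n with
  | zero =>
    have : M = ⊥ := by
      rw [eq_bot_iff]
      intro g hg
      by_contra h0
      refine Ideal.IsPrime.ne_top' (Ideal.eq_top_of_isUnit_mem M hg ?_)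
      have h0 : g ≠ 0 := h0
      rw [eq_C_of_isEmpty g] at h0 ⊢
      exact ((C_ne_zero (σ := Fin 0)).mp h0).isUnit.map C
    rw [this, Ideal.height_bot, Nat.cast_zero]
  | succ n ih =>
    have key : ∀ N : Ideal (Polynomial (MvPolynomial (Fin n) k)), N.IsMaximal →
        N.height = (n + 1 : ℕ) := by
      intro N hN
      have hu : (N.under (MvPolynomial (Fin n) k)).IsMaximal :=
        Polynomial.isMaximal_comap_C_of_isJacobsonRing N
      have hover : N.LiesOver (N.under (MvPolynomial (Fin n) k)) := ⟨rfl⟩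
      rw [Polynomial.height_eq_height_add_one (N.under _) N, ih, Nat.cast_add, Nat.cast_one]
    let e := (finSuccEquiv k n).symm.toRingEquiv
    rw [← e.height_comap M]
    exact key _ (Ideal.comap_isMaximal_of_equiv e)

/-! ### Ideals of maximal minors and their syzygies -/

/-- If no prime divides all `A i`, a vector proportional to `A` over the fraction field is a
multiple of `A`. -/
theorem exists_eq_smul_of_forall_mul_eq {ι T : Type*} [CommRing T] [IsDomain T]
    [UniqueFactorizationMonoid T] {A θ : ι → T} (hA : A ≠ 0)
    (hprime : ∀ p : T, Prime p → ∃ i, ¬ p ∣ A i) (h : ∀ i j, A i * θ j = A j * θ i) :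
    ∃ c : T, θ = c • A := by
  obtain ⟨i, hi⟩ := Function.ne_iff.mp hA
  have hi : A i ≠ 0 := hi
  suffices hdvd : A i ∣ θ i by
    obtain ⟨c, hc⟩ := hdvd
    refine ⟨c, funext fun j => mul_left_cancel₀ hi ?_⟩
    rw [h i j, hc, Pi.smul_apply, smul_eq_mul]
    ring
  -- The prime factors of `d` are cancelled one at a time, each against an `A j` it does not divide.
  have key : ∀ d t : T, d ≠ 0 → (∀ j, d ∣ A j * t) → d ∣ t := by
    intro d
    induction d using UniqueFactorizationMonoid.induction_on_prime with
    | h₁ => intro t h0; exact absurd rfl h0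
    | h₂ x hx => intro t _ _; exact hx.dvd
    | h₃ a p ha hp ih =>
      intro t _ ht
      obtain ⟨j, hj⟩ := hprime p hp
      obtain ⟨s, rfl⟩ := (hp.dvd_or_dvd ((dvd_mul_right p a).trans (ht j))).resolve_left hj
      refine mul_dvd_mul_left p (ih s ha fun j => ?_)
      have := ht j
      rwa [mul_left_comm, mul_dvd_mul_iff_left hp.ne_zero] at this
  exact key (A i) (θ i) hi fun j => ⟨θ j, (h i j).symm⟩

open Matrix in
/-- The part of the Hilbert–Burch theorem that says that a vector orthogonal to the maximal minors
of a matrix is a combination of its rows, when the minors have no common prime factor. -/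
theorem Matrix.exists_eq_sum_smul_of_minors {n : ℕ} {T : Type*} [CommRing T] [IsDomain T]
    [UniqueFactorizationMonoid T] (v : Fin n → Fin (n + 1) → T) {A : Fin (n + 1) → T}
    (hdet : ∀ i, A i = Matrix.det (Matrix.of
      (Fin.snoc (α := fun _ => Fin (n + 1) → T) v (Pi.single i 1))))
    (hA : A ≠ 0) (hprime : ∀ p : T, Prime p → ∃ i, ¬ p ∣ A i) :
    (∀ j, ∑ i, v j i * A i = 0) ∧ (∀ c : Fin n → T, ∑ j, c j • v j = 0 → c = 0) ∧
    ∀ b : Fin (n + 1) → T, ∑ i, b i * A i = 0 → ∃ c : Fin n → T, b = ∑ j, c j • v j := by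
  set M : (Fin (n + 1) → T) → Matrix (Fin (n + 1)) (Fin (n + 1)) T := fun b =>
    Matrix.of (Fin.snoc (α := fun _ => Fin (n + 1) → T) v b) with hM
  have hrow (b : Fin (n + 1) → T) (w : Fin (n + 1) → T) :
      w ᵥ* M b = ∑ j : Fin n, w j.castSucc • v j + w (Fin.last n) • b := by
    ext i
    simp [Matrix.vecMul, dotProduct, Fin.sum_univ_castSucc, hM]
  have hdetM (b : Fin (n + 1) → T) : (M b).det = ∑ i, b i * A i := by
    have hup : ∀ b', M b' = (M b).updateRow (Fin.last n) b' := by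
      intro b'
      ext r s
      refine Fin.lastCases ?_ (fun r => ?_) r
      · simp [hM]
      · rw [Matrix.updateRow_ne (Fin.castSucc_lt_last r).ne]; simp [hM]
    have hA' : ∀ i, A i = (M b).adjugate i (Fin.last n) := fun i => by
      rw [Matrix.adjugate_apply, ← hup, hdet]
    have := congrFun (congrFun (Matrix.mul_adjugate (M b)) (Fin.last n)) (Fin.last n)
    rw [Matrix.mul_apply] at this
    simp only [Matrix.smul_apply, Matrix.one_apply_eq, smul_eq_mul, mul_one] at this
    rw [← this]
    refine Finset.sum_congr rfl fun i _ => ?_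
    rw [hA']
    simp [hM]
  obtain ⟨i, hi⟩ := Function.ne_iff.mp hA
  have hi : A i ≠ 0 := hi
  have hinj : ∀ c : Fin n → T, ∑ j, c j • v j = 0 → c = 0 := by
    intro c hc
    have hz : (Fin.snoc (α := fun _ => T) c 0 : Fin (n + 1) → T) ᵥ* M (Pi.single i 1) = 0 := by
      rw [hrow]; simpa using hc
    have hdi : (M (Pi.single i 1)).det ≠ 0 := by rw [hM, ← hdet]; exact hi
    have := Matrix.eq_zero_of_vecMul_eq_zero hdi hz
    funext j
    simpa using congrFun this j.castSucc
  have hrows : ∀ j, ∑ i, v j i * A i = 0 := fun j => by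
    rw [← hdetM]
    exact Matrix.det_zero_of_row_eq (Fin.castSucc_lt_last j).ne (by ext s; simp [hM])
  refine ⟨hrows, hinj, fun b hb => ?_⟩
  -- Cramer's rule: expand `b` times the adjugate times the matrix. The coefficient of the extra row
  -- is `∑ b_r A_r = 0`, leaving only the rows `v`.
  have hc : ∀ i, ∃ c : Fin n → T, A i • b = ∑ j, c j • v j := by
    intro i
    have h := congrArg (fun N => b ᵥ* N) (Matrix.adjugate_mul (M (Pi.single i 1)))
    simp only [← Matrix.vecMul_vecMul, Matrix.vecMul_smul, Matrix.vecMul_one] at h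
    rw [hrow] at h
    have h0 : (b ᵥ* (M (Pi.single i 1)).adjugate) (Fin.last n) = 0 := by
      change ∑ r, b r * (M (Pi.single i 1)).adjugate r (Fin.last n) = 0
      rw [← hb]
      refine Finset.sum_congr rfl fun r _ => congrArg (b r * ·) ?_
      rw [Matrix.adjugate_apply, hdet]
      congr 1
      ext r s
      refine Fin.lastCases ?_ (fun r => ?_) r
      · simp [hM]
      · rw [Matrix.updateRow_ne (Fin.castSucc_lt_last r).ne]; simp [hM]
    rw [h0, zero_smul, add_zero] at h
    exact ⟨fun j => (b ᵥ* (M (Pi.single i 1)).adjugate) j.castSucc, by rw [hdet]; exact h.symm⟩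
  choose c hc using hc
  -- Independence of the rows makes the coefficient vectors for different `i` compatible, so they
  -- share a factor `d` with `c s j = d j * A s`, and `A i` can be cancelled.
  have hprop : ∀ r s, A r • c s = A s • c r := by
    intro r s
    rw [← sub_eq_zero]
    apply hinj
    simp only [Pi.sub_apply, Pi.smul_apply, sub_smul, smul_assoc, Finset.sum_sub_distrib,
      ← Finset.smul_sum, ← hc]
    rw [smul_comm, sub_self]
  have hd : ∀ j, ∃ d : T, (fun s => c s j) = d • A := fun j =>
    exists_eq_smul_of_forall_mul_eq hA hprime fun r s => congrFun (hprop r s) j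
  choose d hd using hd
  refine ⟨d, funext fun s => mul_left_cancel₀ hi ?_⟩
  have := congrFun (hc i) s
  rw [Pi.smul_apply, smul_eq_mul] at this
  rw [this, Finset.sum_apply, Finset.sum_apply, Finset.mul_sum]
  refine Finset.sum_congr rfl fun j _ => ?_
  have := congrFun (hd j) i
  simp only [Pi.smul_apply, smul_eq_mul] at this ⊢
  rw [this]
  ring

/-- Let `J` be the ideal generated by the `A i`, with a free resolution of length one whose first
syzygies are `v`. If three elements of a regular sequence multiply `h` into `J`, then `h ∈ J`. -/
theorem mem_span_range_of_regular_triple {ι κ T : Type*} [Fintype ι] [Fintype κ] [CommRing T]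
    [IsDomain T] (v : κ → ι → T) (A : ι → T) (hv : ∀ j, ∑ i, v j i * A i = 0)
    (hinj : ∀ c : κ → T, ∑ j, c j • v j = 0 → c = 0)
    (hker : ∀ b : ι → T, ∑ i, b i * A i = 0 → ∃ c : κ → T, b = ∑ j, c j • v j)
    {f₁ f₂ f₃ : T} (h1 : f₁ ≠ 0) (h12 : ∀ c, f₁ ∣ f₂ * c → f₁ ∣ c)
    (h123 : ∀ c, f₃ * c ∈ Ideal.span {f₁, f₂} → c ∈ Ideal.span {f₁, f₂}) {h : T}
    (hf₁ : f₁ * h ∈ Ideal.span (Set.range A)) (hf₂ : f₂ * h ∈ Ideal.span (Set.range A))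
    (hf₃ : f₃ * h ∈ Ideal.span (Set.range A)) : h ∈ Ideal.span (Set.range A) := by
  rw [Ideal.mem_span_range_iff_exists_fun] at hf₁ hf₂ hf₃ ⊢
  obtain ⟨b₁, hb₁⟩ := hf₁
  obtain ⟨b₂, hb₂⟩ := hf₂
  obtain ⟨b₃, hb₃⟩ := hf₃
  have syz : ∀ (f g : T) (b b' : ι → T), ∑ i, b i * A i = f * h → ∑ i, b' i * A i = g * h →
      ∃ c : κ → T, g • b - f • b' = ∑ j, c j • v j := by
    intro f g b b' hb hb'
    apply hker
    simp only [Pi.sub_apply, Pi.smul_apply, smul_eq_mul, sub_mul, mul_assoc,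
      Finset.sum_sub_distrib, ← Finset.mul_sum, hb, hb']
    ring
  obtain ⟨c₁₂, h₁₂⟩ := syz f₁ f₂ b₁ b₂ hb₁ hb₂
  obtain ⟨c₁₃, h₁₃⟩ := syz f₁ f₃ b₁ b₃ hb₁ hb₃
  obtain ⟨c₂₃, h₂₃⟩ := syz f₂ f₃ b₂ b₃ hb₂ hb₃
  -- The three syzygies satisfy a cocycle identity, which descends to their coefficients because the
  -- rows are independent.
  have hrel : f₃ • c₁₂ - f₂ • c₁₃ + f₁ • c₂₃ = 0 := by
    apply hinj
    simp only [Pi.add_apply, Pi.sub_apply, Pi.smul_apply, add_smul, sub_smul, smul_assoc,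
      Finset.sum_sub_distrib, Finset.sum_add_distrib, ← Finset.smul_sum, ← h₁₂, ← h₁₃, ← h₂₃]
    ext i
    simp only [Pi.add_apply, Pi.sub_apply, Pi.smul_apply, smul_eq_mul, Pi.zero_apply]
    ring
  have huw : ∀ j, ∃ u w, u * f₁ + w * f₂ = c₁₂ j := by
    intro j
    refine Ideal.mem_span_pair.mp (h123 _ (Ideal.mem_span_pair.mpr ⟨-c₂₃ j, c₁₃ j, ?_⟩))
    have := congrFun hrel j
    simp only [Pi.add_apply, Pi.sub_apply, Pi.smul_apply, smul_eq_mul, Pi.zero_apply] at this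
    linear_combination -this
  choose u w huw using huw
  -- Correcting `b₁` by the syzygy `∑ w_j v_j` makes it divisible by `f₁`; the quotient expresses
  -- `h` in terms of the `A i`.
  have hdvd : ∀ i, ∃ d, b₁ i - (∑ j, w j • v j) i = f₁ * d := by
    intro i
    refine h12 _ ⟨b₂ i + (∑ j, u j • v j) i, ?_⟩
    have := congrFun h₁₂ i
    have hs : (∑ j, c₁₂ j • v j) i = f₁ * (∑ j, u j • v j) i + f₂ * (∑ j, w j • v j) i := by
      simp only [Finset.sum_apply, Pi.smul_apply, smul_eq_mul, Finset.mul_sum,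
        ← Finset.sum_add_distrib]
      exact Finset.sum_congr rfl fun j _ => by rw [← huw]; ring
    rw [hs] at this
    simp only [Pi.sub_apply, Pi.smul_apply, smul_eq_mul] at this
    linear_combination this
  choose d hd using hdvd
  refine ⟨d, mul_left_cancel₀ h1 ?_⟩
  have hz : ∑ i, (∑ j, w j • v j) i * A i = 0 := by
    simp only [Finset.sum_apply, Pi.smul_apply, smul_eq_mul, Finset.sum_mul]
    rw [Finset.sum_comm]
    simp only [mul_assoc, ← Finset.mul_sum, hv, mul_zero, Finset.sum_const_zero]
  rw [← hb₁, Finset.mul_sum, ← sub_zero (∑ i, b₁ i * A i), ← hz, ← Finset.sum_sub_distrib]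
  exact Finset.sum_congr rfl fun i _ => by rw [← mul_assoc, ← hd, sub_mul]

noncomputable section

namespace ProjFoliation

open MvPolynomial

/-! ### Heights of primes containing homogeneous polynomials -/

/-- A prime, homogeneous or not, that contains a set of homogeneous polynomials whose zero set in
`ℙⁿ` has codimension at least `k` has height at least `k`, for `k ≤ n + 1`. -/
theorem le_height_of_le_projCodim {n k : ℕ} {s : Set (CoordRing n)}
    (hs : ∀ f ∈ s, ∃ d, f.IsHomogeneous d) (hk : k ≤ n + 1) (hcodim : k ≤ projCodim s)
    (P : Ideal (CoordRing n)) (hP : P.IsPrime) (hsP : s ⊆ P) : k ≤ P.height := by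
  set Q := P.homogeneousCore (grading n) with hQ
  have hQP : Q.toIdeal ≤ P := Ideal.toIdeal_homogeneousCore_le _ P
  have hQprime : Q.toIdeal.IsPrime := Ideal.IsPrime.homogeneousCore hP
  have hsQ : s ⊆ Q.toIdeal := fun f hf => by
    obtain ⟨d, hd⟩ := hs f hf
    exact Ideal.mem_homogeneousCore_of_homogeneous_of_mem
      ⟨d, (mem_homogeneousSubmodule d f).mpr hd⟩ (hsP hf)
  refine le_trans ?_ (Ideal.height_mono hQP)
  -- The irrelevant ideal is not a point of `ℙⁿ`, so the codimension says nothing about it; its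
  -- height `n + 1` is where the bound on `k` enters.
  by_cases hirr : HomogeneousIdeal.irrelevant (grading n) ≤ Q
  · have hsurj : Function.Surjective (constantCoeff : CoordRing n →+* ℂ) :=
      fun c => ⟨C c, constantCoeff_C _ c⟩
    have hM : (RingHom.ker (constantCoeff : CoordRing n →+* ℂ)).IsMaximal :=
      RingHom.ker_isMaximal_of_surjective _ hsurj
    have hMQ : RingHom.ker (constantCoeff : CoordRing n →+* ℂ) ≤ Q.toIdeal := fun f hf => by
      refine hirr ((HomogeneousIdeal.mem_irrelevant_iff _ f).mpr ?_)
      rw [GradedRing.proj_apply]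
      refine (decomposition.decompose'_apply f 0).trans ?_
      rw [homogeneousComponent_zero]
      have : coeff 0 f = 0 := hf
      rw [this, C_0]
    calc (k : ℕ∞) ≤ (n + 1 : ℕ) := by exact_mod_cast hk
      _ = _ := (height_of_isMaximal (RingHom.ker (constantCoeff : CoordRing n →+* ℂ))).symm
      _ ≤ _ := Ideal.height_mono hMQ
  · exact hcodim.trans (iInf₂_le (⟨Q, hQprime, hirr⟩ : ProjectiveSpectrum (grading n)) hsQ)

section

variable {n e : ℕ} {ω : OneForm n}

lemma isHomogeneous_exteriorD {d : ℕ} (hω : ∀ i, (ω i).IsHomogeneous d) (i j : Fin (n + 1)) :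
    (exteriorD ω i j).IsHomogeneous (d - 1) :=
  (hω j).pderiv.sub (hω i).pderiv

/-- `dω` is antisymmetric. -/
lemma exteriorD_swap (ω : OneForm n) (i j : Fin (n + 1)) :
    exteriorD ω i j = -exteriorD ω j i := by
  simp [exteriorD]

/-- Cartan's formula for the radial vector field: `i_R dω = e ω`. -/
lemma IsFoliation.sum_X_mul_exteriorD (hω : IsFoliation e ω) (j : Fin (n + 1)) :
    ∑ i, X i * exteriorD ω i j = (e : CoordRing n) * ω j := by
  have h1 := (hω.homogeneous j).sum_X_mul_pderiv
  -- Differentiating `i_R ω = 0` gives `ω_j + ∑ x_i ∂_j ω_i = 0`, to be combined with Euler's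
  -- identity.
  have h2 := congrArg (pderiv j) hω.contract_radial
  simp only [contract, radial, map_sum, Derivation.leibniz, smul_eq_mul, map_zero, pderiv_X,
    Finset.sum_add_distrib, Pi.single_apply, mul_ite, mul_one, mul_zero,
    Finset.sum_ite_eq', Finset.mem_univ, if_true] at h2
  simp only [exteriorD, mul_sub, Finset.sum_sub_distrib]
  rw [h1, nsmul_eq_mul, Nat.cast_sub (one_le_two.trans hω.two_le)]
  linear_combination -h2

/-- The coefficients of `ω` have no common prime factor. -/
lemma IsFoliation.exists_not_dvd (hn : 1 ≤ n) (hω : IsFoliation e ω) (p : CoordRing n)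
    (hp : Prime p) : ∃ i, ¬ p ∣ ω i := by
  by_contra! h
  have h2 := le_height_of_le_projCodim (k := 2) (s := Set.range ω)
    (by rintro _ ⟨i, rfl⟩; exact ⟨_, hω.homogeneous i⟩) (by omega) hω.two_le_codim
    (Ideal.span {p}) ((Ideal.span_singleton_prime hp.ne_zero).mpr hp)
    (by rintro _ ⟨i, rfl⟩; exact Ideal.mem_span_singleton.mpr (h i))
  exact absurd (h2.trans (Ideal.height_span_singleton_le_one hp.not_isUnit)) (by norm_num)

/-- On `ℙ¹`, the coefficient of `dω` is a unit. -/
lemma IsFoliation.isUnit_exteriorD {ω : OneForm 1} (hω : IsFoliation e ω) :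
    IsUnit (exteriorD ω 0 1) := by
  have he : IsUnit (e : CoordRing 1) := by
    have : (e : ℂ) ≠ 0 := by have := hω.two_le; exact_mod_cast (by omega : e ≠ 0)
    simpa using this.isUnit.map (C : ℂ →+* CoordRing 1)
  have hdvd : ∀ p, p ∣ exteriorD ω 0 1 → ∀ j, p ∣ ω j := by
    intro p hp j
    rw [← he.dvd_mul_left, ← hω.sum_X_mul_exteriorD j]
    refine Finset.dvd_sum fun i _ => Dvd.dvd.mul_left ?_ _
    have h10 : p ∣ exteriorD ω 1 0 := by rw [exteriorD_swap]; exact hp.neg_right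
    fin_cases i <;> fin_cases j
    · simp [exteriorD]
    · exact hp
    · exact h10
    · simp [exteriorD]
  by_contra hu
  by_cases h0 : exteriorD ω 0 1 = 0
  · exact hω.ne_zero (funext fun j => zero_dvd_iff.mp (hdvd 0 (by rw [h0]) j))
  · obtain ⟨p, hp, hpd⟩ := WfDvdMonoid.exists_irreducible_factor hu h0
    obtain ⟨i, hi⟩ := hω.exists_not_dvd le_rfl p hp.prime
    exact hi (hdvd p hpd i)

end

/-! ### The three ideals -/

section

variable {m e : ℕ} {ω : OneForm (m + 1)}

/-- `J(ω)` is perfect of codimension two for split `ω`, so the ideal of coefficients of `dω`, of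
codimension at least three, contains a nonzerodivisor modulo `J(ω)`. -/
theorem mem_singIdeal_of_mul_exteriorD_mem (hω : IsGeneric e ω) (hsplit : IsSplit ω)
    {h : CoordRing (m + 1)} (hh : ∀ i j, h * exteriorD ω i j ∈ singIdeal ω) :
    h ∈ singIdeal ω := by
  obtain ⟨hF, -, hcodim⟩ := hω
  -- On `ℙ¹` the cone has dimension two, so no prime has height three and the unit coefficient of
  -- `dω` is used instead.
  obtain rfl | hm := Nat.eq_zero_or_pos m
  · exact (Ideal.mul_unit_mem_iff_mem _ hF.isUnit_exteriorD).mp (hh 0 1)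
  by_contra hJ
  obtain ⟨P, hP, hle⟩ := exists_le_isAssociatedPrime_of_isNoetherianRing (CoordRing (m + 1))
    (Ideal.Quotient.mk (singIdeal ω) h) (mt Ideal.Quotient.eq_zero_iff_mem.mp hJ)
  obtain ⟨hPp, y, hy⟩ := isAssociatedPrime_iff.mp hP
  obtain ⟨y, rfl⟩ := Ideal.Quotient.mk_surjective y
  have hmem : ∀ a, a ∈ P ↔ a * y ∈ singIdeal ω := by
    intro a
    rw [hy, Submodule.mem_colon_singleton, Submodule.mem_bot]
    exact Ideal.Quotient.eq_zero_iff_mem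
  have hheight : 3 ≤ P.height := by
    refine le_height_of_le_projCodim (k := 3) ?_ (by omega) hcodim P hPp ?_
    · rintro _ ⟨ij, rfl⟩
      exact ⟨_, isHomogeneous_exteriorD hF.homogeneous _ _⟩
    · rintro _ ⟨ij, rfl⟩
      refine hle ?_
      rw [Submodule.mem_colon_singleton, Submodule.mem_bot]
      refine Ideal.Quotient.eq_zero_iff_mem.mpr ?_
      change exteriorD ω ij.1 ij.2 * h ∈ singIdeal ω
      rw [mul_comm]
      exact hh _ _
  obtain ⟨f₁, h1, f₂, h2, f₃, h3, hf₁, h12, h123⟩ := exists_regular_triple P hheight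
  obtain ⟨V, hV⟩ := hsplit
  set v : Fin (m + 1) → OneForm (m + 1) :=
    Fin.snoc (α := fun _ => VectorField (m + 1)) (fun j => V j.rev) (radial (m + 1)) with hv
  obtain ⟨hrows, hinj, hker⟩ := Matrix.exists_eq_sum_smul_of_minors v (A := ω) hV hF.ne_zero
    (hF.exists_not_dvd (by omega))
  refine hPp.ne_top ((Ideal.eq_top_iff_one _).mpr ((hmem 1).mpr ?_))
  rw [one_mul]
  exact mem_span_range_of_regular_triple v ω hrows hinj hker hf₁ h12
    h123 ((hmem _).mp h1) ((hmem _).mp h2) ((hmem _).mp h3)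

theorem singIdeal_eq_kupkaIdeal (hω : IsGeneric e ω) (hsplit : IsSplit ω) :
    singIdeal ω = kupkaIdeal ω := by
  refine le_antisymm le_sup_right (sup_le (fun h hh => ?_) le_rfl)
  refine mem_singIdeal_of_mul_exteriorD_mem hω hsplit fun i j => ?_
  rw [Ideal.mem_torsionOf_iff] at hh
  exact Ideal.Quotient.eq_zero_iff_mem.mp (congrFun (congrFun hh i) j)

theorem unfoldingIdeal_eq_singIdeal (hω : IsGeneric e ω) (hsplit : IsSplit ω) :
    unfoldingIdeal ω = singIdeal ω := by
  refine le_antisymm ?_ (Ideal.span_le.mpr ?_)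
  · rintro h ⟨η, hη⟩
    refine mem_singIdeal_of_mul_exteriorD_mem hω hsplit fun i j => ?_
    rw [hη]
    exact Ideal.sub_mem _ (Ideal.mul_mem_right _ _ (Ideal.subset_span ⟨i, rfl⟩))
      (Ideal.mul_mem_right _ _ (Ideal.subset_span ⟨j, rfl⟩))
  · rintro _ ⟨k, rfl⟩
    -- Contracting `ω ∧ dω = 0` with `∂_k` gives `A_k dω = ω ∧ i_{∂_k} dω`.
    refine ⟨fun j => exteriorD ω k j, fun i j => ?_⟩
    have := congrFun (congrFun (congrFun hω.1.integrable k) i) j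
    simp only [wedgeOneTwo, Pi.zero_apply] at this
    simp only [wedgeOneOne]
    linear_combination this

end

/-! ### Automorphisms of `ℙⁿ[ε]` and unfoldings -/

/-- The automorphism `a + b ε ↦ a + (b + D a) ε` of `S[ε]` attached to a derivation `D` of `S`. -/
def thickAlgEquiv {n : ℕ} (D : Derivation ℂ (CoordRing n) (CoordRing n)) :
    ThickRing n ≃ₐ[ℂ] ThickRing n where
  toFun a := TrivSqZeroExt.inl a.fst + TrivSqZeroExt.inr (a.snd + D a.fst)
  invFun a := TrivSqZeroExt.inl a.fst + TrivSqZeroExt.inr (a.snd - D a.fst)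
  left_inv a := by ext <;> simp
  right_inv a := by ext <;> simp
  map_mul' a b := by
    apply TrivSqZeroExt.ext
    · simp
    · simp only [TrivSqZeroExt.fst_mul, TrivSqZeroExt.snd_mul, TrivSqZeroExt.fst_add,
        TrivSqZeroExt.snd_add, TrivSqZeroExt.fst_inl, TrivSqZeroExt.snd_inl,
        TrivSqZeroExt.fst_inr, TrivSqZeroExt.snd_inr, Derivation.leibniz, smul_eq_mul,
        MulOpposite.smul_eq_mul_unop, MulOpposite.unop_op, add_zero, zero_add]
      ring
  map_add' a b := by
    apply TrivSqZeroExt.ext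
    · simp
    · simp only [TrivSqZeroExt.fst_add, TrivSqZeroExt.snd_add, TrivSqZeroExt.snd_inl,
        TrivSqZeroExt.snd_inr, map_add, zero_add]
      exact add_add_add_comm _ _ _ _
  commutes' r := by ext <;> simp [TrivSqZeroExt.algebraMap_eq_inl']

section

variable {n : ℕ} (D : Derivation ℂ (CoordRing n) (CoordRing n)) (a : ThickRing n)

@[simp]
lemma thickAlgEquiv_fst : (thickAlgEquiv D a).fst = a.fst := by
  change (TrivSqZeroExt.inl a.fst + TrivSqZeroExt.inr (a.snd + D a.fst) : ThickRing n).fst = _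
  simp

@[simp]
lemma thickAlgEquiv_snd : (thickAlgEquiv D a).snd = a.snd + D a.fst := by
  change (TrivSqZeroExt.inl a.fst + TrivSqZeroExt.inr (a.snd + D a.fst) : ThickRing n).snd = _
  simp

end

/-- The automorphism `xᵢ ↦ xᵢ + ε Zᵢ` of `ℙⁿ[ε]` attached to a linear vector field `Z`. -/
def thickAut {n : ℕ} (Z : VectorField n) (hZ : ∀ i, (Z i).IsHomogeneous 1) : ThickAut n where
  toAlgEquiv := thickAlgEquiv (mkDerivation ℂ Z)
  map_eps := by ext <;> simp
  restrict a := thickAlgEquiv_fst _ a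
  graded i := by simpa using hZ i

section

variable {n : ℕ} (Z : VectorField n) (hZ : ∀ i, (Z i).IsHomogeneous 1) (w : ThickOneForm n)

lemma thickAut_pullback_de :
    ((thickAut Z hZ).pullback w).de = w.de + ∑ j, Z j * (w.dx j).fst := by
  simp [ThickAut.pullback, ThickAut.coord, thickAut, mul_comm]

/-- Both sides are derivations, so agreement on the variables suffices. -/
lemma mkDerivation_eq_sum (f : CoordRing n) : mkDerivation ℂ Z f = ∑ j, Z j * pderiv j f := by
  have hsum (D : Fin (n + 1) → Derivation ℂ (CoordRing n) (CoordRing n)) (g : CoordRing n) :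
      (∑ j, D j) g = ∑ j, D j g := by
    rw [← Derivation.coeFnAddMonoidHom_apply, map_sum, Finset.sum_apply]
    rfl
  have : mkDerivation ℂ Z = ∑ j, Z j • pderiv (R := ℂ) (σ := Fin (n + 1)) j := by
    refine derivation_ext fun i => ?_
    rw [mkDerivation_X, hsum]
    simp [pderiv_X, Pi.single_apply]
  rw [this, hsum]
  rfl

lemma thickAut_pullback_dx_fst (i : Fin (n + 1)) :
    (((thickAut Z hZ).pullback w).dx i).fst = (w.dx i).fst := by
  simp [ThickAut.pullback, ThickAut.coord, thickAut, thickPderiv, TrivSqZeroExt.fst_sum,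
    pderiv_X, Pi.single_apply]

/-- The `ε`-part of the pullback changes by the Lie derivative. -/
lemma thickAut_pullback_dx_snd (i : Fin (n + 1)) :
    (((thickAut Z hZ).pullback w).dx i).snd = (w.dx i).snd +
      ∑ j, (Z j * pderiv j (w.dx i).fst + (w.dx j).fst * pderiv i (Z j)) := by
  simp [ThickAut.pullback, ThickAut.coord, thickAut, thickPderiv, TrivSqZeroExt.snd_sum,
    pderiv_X, Pi.single_apply, Finset.sum_add_distrib, mkDerivation_eq_sum]
  ring

end

/-- A linear combination with homogeneous coefficients of degree `d` that is homogeneous of degree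
`d + k` can be taken with coefficients of degree `k`. -/
lemma exists_isHomogeneous_sum_mul_eq {n d k : ℕ} {A : Fin (n + 1) → CoordRing n}
    (hA : ∀ i, (A i).IsHomogeneous d) {h : CoordRing n} (hh : h.IsHomogeneous (d + k))
    (hmem : h ∈ Ideal.span (Set.range A)) :
    ∃ Y : Fin (n + 1) → CoordRing n, (∀ i, (Y i).IsHomogeneous k) ∧ ∑ i, Y i * A i = h := by
  obtain ⟨y, rfl⟩ := Ideal.mem_span_range_iff_exists_fun.mp hmem
  refine ⟨fun i => DirectSum.decompose (grading n) (y i) k, fun i =>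
    (mem_homogeneousSubmodule k _).mp (SetLike.coe_mem (DirectSum.decompose (grading n) (y i) k)), ?_⟩
  have h1 := DirectSum.decompose_of_mem_same (grading n)
    ((mem_homogeneousSubmodule (d + k) _).mpr hh)
  rw [← h1, DirectSum.decompose_sum, DFinsupp.finsetSum_apply, AddSubmonoidClass.coe_finsetSum]
  refine Finset.sum_congr rfl fun i _ => ?_
  rw [mul_comm (y i), DirectSum.coe_decompose_mul_add_of_left_mem (grading n)
    ((mem_homogeneousSubmodule d _).mpr (hA i)), mul_comm]

/-- Quotients of homogeneous polynomials of the same degree are constant. -/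
lemma exists_eq_C_of_isHomogeneous_mul {n d : ℕ} {c f : CoordRing n} (hf : f.IsHomogeneous d)
    (hf0 : f ≠ 0) (hcf : (c * f).IsHomogeneous d) : ∃ r, c = C r := by
  by_cases hc : c = 0
  · exact ⟨0, by rw [hc, C_0]⟩
  · have h := hcf.totalDegree (mul_ne_zero hc hf0)
    rw [totalDegree_mul_of_isDomain hc hf0, hf.totalDegree hf0] at h
    exact ⟨_, totalDegree_eq_zero_iff_eq_C.mp (by omega)⟩

theorem isomorphicUnfoldings_trivialUnfolding {m e : ℕ} {ω : OneForm (m + 1)}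
    (hω : IsGeneric e ω) (hsplit : IsSplit ω) {w : ThickOneForm (m + 1)}
    (hw : IsUnfolding e ω w) : IsomorphicUnfoldings w (trivialUnfolding ω) := by
  have hF := hω.1
  have he := hF.two_le
  obtain ⟨η, hη⟩ : ∃ η : OneForm (m + 1), ∀ j, η j = (w.dx j).snd - pderiv j w.de :=
    ⟨_, fun _ => rfl⟩
  have hde : ∀ i j, w.de * exteriorD ω i j = ω i * η j - ω j * η i := by
    intro i j
    have h := hw.integrable.2 i j
    simp only [ThickOneForm.derivDx, thickPderiv, wedgeOneOne, ThickOneForm.derivDe, hw.restrict,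
      ← hη, TrivSqZeroExt.fst_sub, TrivSqZeroExt.fst_add, TrivSqZeroExt.fst_inl,
      TrivSqZeroExt.fst_inr, add_zero] at h
    exact sub_eq_zero.mp h
  have hmem : w.de ∈ singIdeal ω := by
    rw [← unfoldingIdeal_eq_singIdeal hω hsplit]
    exact ⟨η, hde⟩
  obtain ⟨Y, hY, hsum⟩ := exists_isHomogeneous_sum_mul_eq (k := 1) hF.homogeneous
    (by rw [Nat.sub_add_cancel (by omega)]; exact hw.homogeneous_de) hmem
  obtain ⟨θ, hθ⟩ : ∃ θ : OneForm (m + 1), ∀ i, θ i = (w.dx i).snd -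
      ∑ j, (Y j * pderiv j (ω i) + ω j * pderiv i (Y j)) := ⟨_, fun _ => rfl⟩
  -- Here `θ = ω₁ - L_Y ω`. Cartan's formula with `i_Y ω = h` turns it into `(ω₁ - dh) - i_Y dω`.
  have hθη : ∀ i, θ i = η i - ∑ j, Y j * exteriorD ω j i := by
    intro i
    have h : ∑ j, (Y j * pderiv i (ω j) + ω j * pderiv i (Y j)) = pderiv i w.de := by
      rw [← hsum, map_sum]
      exact Finset.sum_congr rfl fun j _ => by rw [Derivation.leibniz]; rfl
    rw [hθ, hη, ← h, sub_sub, ← Finset.sum_add_distrib]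
    refine congrArg _ (Finset.sum_congr rfl fun j _ => ?_)
    rw [exteriorD]
    ring
  -- Contracting integrability with `Y` gives `h dω = ω ∧ i_Y dω`; comparison with `h dω = ω ∧ η`
  -- yields `ω ∧ θ = 0`.
  have hprop : ∀ i k, ω i * θ k = ω k * θ i := by
    intro i k
    have h : ∑ j, Y j * (ω i * exteriorD ω j k - ω k * exteriorD ω j i) =
        w.de * exteriorD ω i k := by
      rw [← hsum, Finset.sum_mul]
      refine Finset.sum_congr rfl fun j _ => ?_
      have := congrFun (congrFun (congrFun hF.integrable j) i) k
      simp only [wedgeOneTwo, Pi.zero_apply] at this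
      linear_combination -Y j * this
    simp only [mul_sub, Finset.sum_sub_distrib, mul_left_comm _ (ω _), ← Finset.mul_sum] at h
    rw [hθη, hθη]
    linear_combination -h - hde i k
  obtain ⟨c, hc⟩ := exists_eq_smul_of_forall_mul_eq hF.ne_zero (hF.exists_not_dvd (by omega)) hprop
  have hθhom : ∀ i, (θ i).IsHomogeneous (e - 1) := by
    intro i
    rw [hθ]
    refine (hw.homogeneous_snd i).sub (IsHomogeneous.sum _ _ _ fun j _ => IsHomogeneous.add ?_ ?_)
    · have h := (hY j).mul ((hF.homogeneous i).pderiv (i := j))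
      rwa [show 1 + (e - 1 - 1) = e - 1 by omega] at h
    · exact (hF.homogeneous j).mul (hY j).pderiv
  obtain ⟨i₀, hi₀⟩ := Function.ne_iff.mp hF.ne_zero
  obtain ⟨r, rfl⟩ := exists_eq_C_of_isHomogeneous_mul (hF.homogeneous i₀) hi₀
    (by simpa [hc] using hθhom i₀)
  -- The field `-Y` cancels `h dε` and leaves `θ = r ω` in the `ε`-part; `-(r/e) R` removes it since
  -- `L_R ω = e ω`, without disturbing the `dε` term since `i_R ω = 0`.
  obtain ⟨Z, hZ⟩ : ∃ Z : VectorField (m + 1), ∀ i, Z i = -(Y i + C (r / e) * X i) :=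
    ⟨_, fun _ => rfl⟩
  have hZhom : ∀ i, (Z i).IsHomogeneous 1 := fun i => by
    rw [hZ]
    exact ((hY i).add (isHomogeneous_C_mul_X _ i)).neg
  have hre : C (r / e) * (e : CoordRing (m + 1)) = C r := by
    have : (e : ℂ) ≠ 0 := by exact_mod_cast (by omega : e ≠ 0)
    rw [← map_natCast (C : ℂ →+* CoordRing (m + 1)), ← C_mul, div_mul_cancel₀ _ this]
  have hR : ∑ i, X i * ω i = 0 := hF.contract_radial
  refine ⟨thickAut Z hZhom, ThickOneForm.ext (funext fun i => TrivSqZeroExt.ext ?_ ?_) ?_⟩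
  · rw [thickAut_pullback_dx_fst, hw.restrict]
    rfl
  · rw [thickAut_pullback_dx_snd]
    change _ = 0
    have hEuler := (hF.homogeneous i).sum_X_mul_pderiv
    rw [nsmul_eq_mul, Nat.cast_sub (by omega), Nat.cast_one] at hEuler
    have hi := congrFun hc i
    rw [Pi.smul_apply, smul_eq_mul, hθ] at hi
    have hterm : ∀ j, Z j * pderiv j (ω i) + ω j * pderiv i (Z j) =
        -(Y j * pderiv j (ω i) + ω j * pderiv i (Y j)) -
          C (r / e) * (X j * pderiv j (ω i)) - C (r / e) * (ω j * pderiv i (X j)) := by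
      intro j
      rw [hZ, map_neg, map_add, Derivation.leibniz, pderiv_C]
      simp only [smul_eq_mul]
      ring
    simp only [hw.restrict, hterm, Finset.sum_sub_distrib, Finset.sum_neg_distrib,
      ← Finset.mul_sum, hEuler]
    have hδ : ∑ j, ω j * pderiv i (X j) = ω i := by
      simp [pderiv_X, Pi.single_apply]
    rw [hδ]
    linear_combination hi - ω i * hre
  · rw [thickAut_pullback_de]
    change _ = 0
    simp only [hw.restrict, hZ, neg_mul, add_mul, Finset.sum_neg_distrib, Finset.sum_add_distrib,
      mul_assoc, ← Finset.mul_sum, hR, hsum]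
    ring

end ProjFoliation

end

theorem mainTheorem9 (m e : ℕ) (ω : ProjFoliation.OneForm (m + 1))
    (hω : ProjFoliation.IsGeneric e ω) (hsplit : ProjFoliation.IsSplit ω) :
    ProjFoliation.singIdeal ω = ProjFoliation.kupkaIdeal ω ∧
      ProjFoliation.unfoldingIdeal ω = ProjFoliation.singIdeal ω ∧
      ∀ w : ProjFoliation.ThickOneForm (m + 1), ProjFoliation.IsUnfolding e ω w →
        ProjFoliation.IsomorphicUnfoldings w (ProjFoliation.trivialUnfolding ω) :=
  ⟨ProjFoliation.singIdeal_eq_kupkaIdeal hω hsplit,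
    ProjFoliation.unfoldingIdeal_eq_singIdeal hω hsplit,
    fun _ hw => ProjFoliation.isomorphicUnfoldings_trivialUnfolding hω hsplit hw⟩
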